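/- **Definitions.** For a complex polynomial $p$ let $P$ be the unique polynomial with $P(n)=\sum_{\nu=1}^n p(\nu)$ for all $n\in\mathbb N=\{0,1,2,\dots\}$, and put $S_p(a,b):=P(b)-P(a-1)$ for $a,b\in\mathbb C$. For a negative integer $n$ put $\sum_{\nu=1}^{n}g(\nu):=-\sum_{\nu=n+1}^{0}g(\nu)$. Let $U\subset\mathbb C$ satisfy $U+1\subset U$ (respectively $U-1\subset U$). A function $f\colon U\to\mathbb C$ is a *right* (respectively *left*) *approximate polynomial* of degree $\sigma\in\mathbb N\cup\{-\infty\}$ if there are polynomials $p_n$, all of degree $\sigma$, with $|f(n+x)-p_n(n+x)|\to0$ for every $x\in U$ as $n\to+\infty$ (respectively $n\to-\infty$) through the integers. It is *right* (respectively *left*) *summable* if, moreover, for all $a,b$ with $a,b+1\in U$ the limit $$\lim_{n}\Big(S_{p_n}(n+a,n+b)+\sum_{\nu=1}^{n}\big(f(\nu+a-1)-f(\nu+b)\big)\Big)$$ exists as $n\to+\infty$ (respectively $n\to-\infty$). This limit is then the *right* (respectively *left*) *fractional sum* of $f$ from $a$ to $b$. We say that this fractional sum exists if $f$ is right (respectively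 left) summable on some such domain $U$ with $a,b+1\in U$. **Statement.** Let $z\in\mathbb C$ be not an odd integer, with $2^{-z}\neq2$. For $\nu\in\mathbb C\setminus\{0\}$ let $\nu^z=\exp(z\log\nu)$ with the branch $-\pi<\operatorname{Im}\log\nu\le\pi$, and let $0^z:=0$ (also for $z=0$). Then the right and the left fractional sum of $\nu\mapsto\nu^z$ from $1$ to $-\tfrac12$ both exist, each has a value that does not depend on the choice of the domain $U$, of $\sigma$ and of the polynomials $p_n$, and the two values are equal if and only if $\zeta(-z)=0$, where $\zeta$ is the (analytically continued) Riemann zeta function. -/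

import Mathlib

open Filter Topology Polynomial

/-- Every complex polynomial `p` has a unique polynomial `P` with
`∑_{ν=1}^n p(ν) = P(n)` for all natural numbers `n`. -/
theorem existsUnique_sumPoly (p : ℂ[X]) :
    ∃! P : ℂ[X], ∀ n : ℕ, P.eval (n : ℂ) = ∑ ν ∈ Finset.Icc 1 n, p.eval (ν : ℂ) := by
  have hex : ∃ P : ℂ[X], ∀ n : ℕ, P.eval (n : ℂ) = ∑ ν ∈ Finset.Icc 1 n, p.eval (ν : ℂ) := by
    induction p using Polynomial.induction_on' with
    | add p q hp hq =>
      obtain ⟨P, hP⟩ := hp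
      obtain ⟨Q, hQ⟩ := hq
      exact ⟨P + Q, fun n => by simp [hP, hQ, Finset.sum_add_distrib]⟩
    | monomial k c =>
      let B : ℂ[X] := (Polynomial.bernoulli (k + 1)).map (algebraMap ℚ ℂ)
      refine ⟨C (c / (k + 1)) * (B.comp (X + 1) - C (B.eval 1)), fun n => ?_⟩
      have hk : (k : ℂ) + 1 ≠ 0 := by exact_mod_cast k.succ_ne_zero
      have hB : ∀ m : ℕ, B.eval ((m : ℂ) + 1) = B.eval (m : ℂ) + (k + 1) * (m : ℂ) ^ k := by
        intro m
        have h := Polynomial.bernoulli_eval_one_add (k + 1) (m : ℚ)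
        have e : ∀ q : ℚ, B.eval (q : ℂ) = (((Polynomial.bernoulli (k + 1)).eval q : ℚ) : ℂ) := by
          intro q
          exact Polynomial.eval_map_apply (f := algebraMap ℚ ℂ)
            (p := Polynomial.bernoulli (k + 1)) q
        have e1 := e (1 + (m : ℚ))
        have e2 := e (m : ℚ)
        rw [h] at e1
        push_cast at e1 e2
        rw [add_comm (m : ℂ) 1, e1, ← e2]
      induction n with
      | zero => simp
      | succ n ih =>
        rw [Finset.sum_Icc_succ_top (by omega), ← ih]
        have h := hB (n + 1)
        simp only [eval_mul, eval_C, eval_sub, eval_comp, eval_add, eval_X, eval_one,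
          eval_monomial] at *
        rw [h]
        push_cast
        field_simp
        ring
  obtain ⟨P, hP⟩ := hex
  refine ⟨P, hP, fun Q hQ => ?_⟩
  refine Polynomial.eq_of_infinite_eval_eq Q P
    ((Set.infinite_range_of_injective (Nat.cast_injective (R := ℂ))).mono ?_)
  rintro _ ⟨n, rfl⟩
  exact (hQ n).trans (hP n).symm

/-- The unique polynomial `P` with `∑_{ν=1}^n p(ν) = P(n)` for all natural numbers `n`. -/
noncomputable def sumPoly (p : ℂ[X]) : ℂ[X] :=
  (existsUnique_sumPoly p).choose

theorem sumPoly_eval_nat (p : ℂ[X]) (n : ℕ) :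
    (sumPoly p).eval (n : ℂ) = ∑ ν ∈ Finset.Icc 1 n, p.eval (ν : ℂ) :=
  (existsUnique_sumPoly p).choose_spec.1 n

/-- The fractional sum `∑_{ν=a}^b p(ν) = P(b) - P(a-1)` of a polynomial. -/
noncomputable def polyFracSum (p : ℂ[X]) (a b : ℂ) : ℂ :=
  (sumPoly p).eval b - (sumPoly p).eval (a - 1)

/-- The sum `∑_{ν=1}^n g(ν)` for an arbitrary integer `n`: the ordinary sum if `n ≥ 0`, and
`-∑_{ν=n+1}^0 g(ν)` if `n < 0`. (One of the two sums below is always empty.) -/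
noncomputable def intSum (g : ℤ → ℂ) (n : ℤ) : ℂ :=
  ∑ ν ∈ Finset.Ioc 0 n, g ν - ∑ ν ∈ Finset.Ioc n 0, g ν

/-- `f : U → ℂ` is a right approximate polynomial of degree `σ` with approximating polynomials
`p n`. Only the values of `f` on `U` matter. The degree `σ = ⊥` stands for `-∞`. -/
def IsRightApproxPoly (U : Set ℂ) (f : ℂ → ℂ) (σ : WithBot ℕ) (p : ℤ → ℂ[X]) : Prop :=
  (∀ u ∈ U, u + 1 ∈ U) ∧ (∀ n, (p n).degree = σ) ∧
    ∀ x ∈ U, Tendsto (fun n : ℤ => ‖f (n + x) - (p n).eval (n + x)‖) atTop (𝓝 0)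

/-- The left analogue, with `n → -∞`. -/
def IsLeftApproxPoly (U : Set ℂ) (f : ℂ → ℂ) (σ : WithBot ℕ) (p : ℤ → ℂ[X]) : Prop :=
  (∀ u ∈ U, u - 1 ∈ U) ∧ (∀ n, (p n).degree = σ) ∧
    ∀ x ∈ U, Tendsto (fun n : ℤ => ‖f (n + x) - (p n).eval (n + x)‖) atBot (𝓝 0)

/-- The expression `∑_{ν=n+a}^{n+b} p_n(ν) + ∑_{ν=1}^n (f(ν+a-1) - f(ν+b))`
whose limit is the fractional sum of `f` from `a` to `b`. -/
noncomputable def fracSumApprox (f : ℂ → ℂ) (p : ℤ → ℂ[X]) (a b : ℂ) (n : ℤ) : ℂ :=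
  polyFracSum (p n) (n + a) (n + b) + intSum (fun ν => f (ν + a - 1) - f (ν + b)) n

/-- `f : U → ℂ` is right summable, with approximating polynomials `p n` of degree `σ`. -/
def IsRightSummable (U : Set ℂ) (f : ℂ → ℂ) (σ : WithBot ℕ) (p : ℤ → ℂ[X]) : Prop :=
  IsRightApproxPoly U f σ p ∧
    ∀ a b : ℂ, a ∈ U → b + 1 ∈ U → ∃ s : ℂ, Tendsto (fracSumApprox f p a b) atTop (𝓝 s)

/-- `f : U → ℂ` is left summable, with approximating polynomials `p n` of degree `σ`. -/
def IsLeftSummable (U : Set ℂ) (f : ℂ → ℂ) (σ : WithBot ℕ) (p : ℤ → ℂ[X]) : Prop :=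
  IsLeftApproxPoly U f σ p ∧
    ∀ a b : ℂ, a ∈ U → b + 1 ∈ U → ∃ s : ℂ, Tendsto (fracSumApprox f p a b) atBot (𝓝 s)

/-- The right fractional sum of `f` from `a` to `b` exists and has the value `s`: `f` is right
summable on some domain that contains `a` and `b + 1`, and the limit is `s`. -/
def HasRightFracSum (f : ℂ → ℂ) (a b s : ℂ) : Prop :=
  ∃ (U : Set ℂ) (σ : WithBot ℕ) (p : ℤ → ℂ[X]), IsRightSummable U f σ p ∧ a ∈ U ∧ b + 1 ∈ U ∧
    Tendsto (fracSumApprox f p a b) atTop (𝓝 s)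

/-- The left fractional sum of `f` from `a` to `b` exists and has the value `s`: `f` is left
summable on some domain that contains `a` and `b + 1`, and the limit is `s`. -/
def HasLeftFracSum (f : ℂ → ℂ) (a b s : ℂ) : Prop :=
  ∃ (U : Set ℂ) (σ : WithBot ℕ) (p : ℤ → ℂ[X]), IsLeftSummable U f σ p ∧ a ∈ U ∧ b + 1 ∈ U ∧
    Tendsto (fracSumApprox f p a b) atBot (𝓝 s)

open Classical in
/-- The value of the right fractional sum (`0` if it does not exist). -/
noncomputable def rightFracSum (f : ℂ → ℂ) (a b : ℂ) : ℂ :=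
  if h : ∃ s, HasRightFracSum f a b s then h.choose else 0

open Classical in
/-- The value of the left fractional sum (`0` if it does not exist). -/
noncomputable def leftFracSum (f : ℂ → ℂ) (a b : ℂ) : ℂ :=
  if h : ∃ s, HasLeftFracSum f a b s then h.choose else 0

open Classical in
/-- The power `ν ↦ ν ^ z` (principal branch, with `arg ν = π` for negative real `ν`), modified
so that it vanishes at `ν = 0` for every `z`. -/
noncomputable def powerFn (z ν : ℂ) : ℂ :=
  if ν = 0 then 0 else ν ^ z

/-! On the half-integers `m / 2`, `m > 0`, the function is `2 ^ (-z) * m ^ z`, so the sum of `ν ^ z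
- (ν - 1/2) ^ z` over `ν = 1, …, n` is `2 ^ (-z)` times the alternating sum of `(-1) ^ j * j ^ z`
over `1 ≤ j ≤ 2n`. The polynomial term of the fractional sum regularizes it. If `P` is the
antidifference of `p`, then `κ k = P (n + k/2) - P (n - 1/2 + k/2)` solves `κ k + κ (k + 1) = p (n +
1/2 + k/2)`; being polynomial in `k`, it is the finite Euler transform of the right-hand side
(`polyFracSum_eq_eulerTransform`). With `p` interpolating the power at `d` consecutive
half-integers, the approximant becomes exactly `2 ^ (-z)` times an Euler-corrected partial sum.

For large `d` these corrected sums converge, because the `d`-th difference of `j ^ z` is `O(j ^ (Re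
z - d))`. The limit `L(z)` is holomorphic for `Re z < d - 2` and is the ordinary alternating series
for `Re z < -2`, so analytic continuation gives `L(z) = (2 ^ (1 + z) - 1) * ζ(-z)`
(`eulerLimit_eq`).

On the negative half-axis the branch only adds a factor `exp (π i z)`, and the reversed direction a
sign. The right and left values are thus `2 ^ (-z) * L(z)` and `-exp (π i z) * 2 ^ (-z) * L(z)`.
Their difference is `ζ(-z)` times factors that the hypotheses on `z` make nonzero.

Independence of the choices holds because the fractional sum of a polynomial of bounded degree is a
fixed linear combination of its values at sufficiently many nodes moving along with `n`
(`tendsto_polyFracSum_zero`). -/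

/-! ### Euler's transformation of alternating sums -/

/-- The truncated Euler transform `∑_{j < d} (-1/2)^j / 2 * Δ^j ψ`, an approximate solution `G` of
`G k + G (k + 1) = ψ k`. -/
noncomputable def eulerTransform (d : ℕ) (ψ : ℕ → ℂ) (k : ℕ) : ℂ :=
  ∑ j ∈ Finset.range d, (-1 / 2) ^ j / 2 * (fwdDiff 1)^[j] ψ k

theorem eulerTransform_succ (d : ℕ) (ψ : ℕ → ℂ) (k : ℕ) :
    eulerTransform (d + 1) ψ k =
      eulerTransform d ψ k + (-1 / 2) ^ d / 2 * (fwdDiff 1)^[d] ψ k :=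
  Finset.sum_range_succ _ _

/-- Identity plus shift is `2 + Δ`; the geometric series for its inverse, cut after `d` terms,
leaves the remainder `(-Δ/2) ^ d`. -/
theorem eulerTransform_add_shift (d : ℕ) (ψ : ℕ → ℂ) (k : ℕ) :
    eulerTransform d ψ k + eulerTransform d ψ (k + 1) =
      ψ k - (-1 / 2) ^ d * (fwdDiff 1)^[d] ψ k := by
  induction d with
  | zero => simp [eulerTransform]
  | succ d ih =>
    have h : (fwdDiff 1)^[d + 1] ψ k = (fwdDiff 1)^[d] ψ (k + 1) - (fwdDiff 1)^[d] ψ k := by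
      rw [Function.iterate_succ_apply']; rfl
    rw [eulerTransform_succ, eulerTransform_succ, h]
    linear_combination ih

theorem eulerTransform_of_le {d e : ℕ} (hde : d ≤ e) {ψ : ℕ → ℂ} {k : ℕ}
    (h : ∀ j, d ≤ j → (fwdDiff 1)^[j] ψ k = 0) :
    eulerTransform e ψ k = eulerTransform d ψ k := by
  induction e, hde using Nat.le_induction with
  | base => rfl
  | succ e he ih => rw [eulerTransform_succ, ih, h e he, mul_zero, add_zero]

theorem fwdDiff_iter_congr_zero {φ ψ : ℕ → ℂ} {m j : ℕ} (h : ∀ i ≤ j, φ i = ψ (m + i)) :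
    (fwdDiff 1)^[j] φ 0 = (fwdDiff 1)^[j] ψ m := by
  rw [fwdDiff_iter_eq_sum_shift, fwdDiff_iter_eq_sum_shift]
  refine Finset.sum_congr rfl fun i hi => ?_
  have := Finset.mem_range.1 hi
  simp [h i (by omega)]

theorem eulerTransform_congr_zero {φ ψ : ℕ → ℂ} {m d : ℕ} (h : ∀ i < d, φ i = ψ (m + i)) :
    eulerTransform d φ 0 = eulerTransform d ψ m := by
  refine Finset.sum_congr rfl fun j hj => ?_
  have := Finset.mem_range.1 hj
  rw [fwdDiff_iter_congr_zero fun i hi => h i (by omega)]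

theorem eulerTransform_const_mul (d : ℕ) (c : ℂ) (ψ : ℕ → ℂ) (k : ℕ) :
    eulerTransform d (fun i => c * ψ i) k = c * eulerTransform d ψ k := by
  have : (fun i => c * ψ i) = c • ψ := rfl
  simp only [eulerTransform, this, fwdDiff_iter_const_smul, Finset.mul_sum, Pi.smul_apply,
    smul_eq_mul]
  exact Finset.sum_congr rfl fun _ _ => by ring

/-- A solution of `κ k + κ (k + 1) = ψ k` that is annihilated by a power of the difference operator
is given by the Euler transform of `ψ`. -/
theorem eq_eulerTransform {κ ψ : ℕ → ℂ} (h : ∀ k, κ k + κ (k + 1) = ψ k) {d e : ℕ}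
    (hκ : ∀ j, e ≤ j → (fwdDiff 1)^[j] κ = 0) (hψ : ∀ j, d ≤ j → (fwdDiff 1)^[j] ψ = 0) (k : ℕ) :
    κ k = eulerTransform d ψ k := by
  -- Truncating at `D` is exact for both sequences: the remainder vanishes on `κ`, and the extra
  -- terms vanish on `ψ`.
  set D := max d e
  have h1 : eulerTransform D ψ k = eulerTransform d ψ k :=
    eulerTransform_of_le (le_max_left _ _) fun j hj => by rw [hψ j hj]; rfl
  have h2 := eulerTransform_add_shift D κ k
  rw [hκ D (le_max_right _ _)] at h2
  have h3 : eulerTransform D ψ k = eulerTransform D κ k + eulerTransform D κ (k + 1) := by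
    rw [eulerTransform, eulerTransform, eulerTransform, ← Finset.sum_add_distrib]
    refine Finset.sum_congr rfl fun j _ => ?_
    have : ψ = κ + fun i => κ (i + 1) := funext fun i => (h i).symm
    rw [this, fwdDiff_iter_add, Pi.add_apply, fwdDiff_iter_comp_add, mul_add]
  rw [← h1, h3, h2]
  simp

/-- The partial alternating sum of `h`, corrected by the Euler transform. -/
noncomputable def eulerPartialSum (d : ℕ) (h : ℕ → ℂ) (M : ℕ) : ℂ :=
  ∑ j ∈ Finset.Ico 1 M, (-1) ^ j * h j + (-1) ^ M * eulerTransform d h M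

theorem eulerPartialSum_succ (d : ℕ) (h : ℕ → ℂ) (M : ℕ) :
    eulerPartialSum d h (M + 2) = eulerPartialSum d h 1 +
      ∑ j ∈ Finset.range (M + 1), (-1) ^ (j + 1) * ((-1 / 2) ^ d * (fwdDiff 1)^[d] h (j + 1)) := by
  have step : ∀ K, 1 ≤ K → eulerPartialSum d h (K + 1) =
      eulerPartialSum d h K + (-1) ^ K * ((-1 / 2) ^ d * (fwdDiff 1)^[d] h K) := by
    intro K hK
    have := eulerTransform_add_shift d h K
    rw [eulerPartialSum, eulerPartialSum, Finset.sum_Ico_succ_top hK, pow_succ]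
    linear_combination (-(-1) ^ K) * this
  induction M with
  | zero => simpa using step 1 le_rfl
  | succ M ih => rw [step (M + 2) (by omega), ih, Finset.sum_range_succ _ (M + 1)]; ring

theorem tendsto_eulerPartialSum {d : ℕ} {h : ℕ → ℂ}
    (hs : Summable fun j : ℕ => (-1) ^ (j + 1) * ((-1 / 2) ^ d * (fwdDiff 1)^[d] h (j + 1))) :
    Tendsto (eulerPartialSum d h) atTop (𝓝 (eulerPartialSum d h 1 +
      ∑' j : ℕ, (-1) ^ (j + 1) * ((-1 / 2) ^ d * (fwdDiff 1)^[d] h (j + 1)))) := by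
  rw [← tendsto_add_atTop_iff_nat 2]
  simp_rw [eulerPartialSum_succ]
  exact ((tendsto_add_atTop_iff_nat 1).2 hs.hasSum.tendsto_sum_nat).const_add _

/-! ### Differences of powers -/

theorem hasDerivAt_fwdDiff_iter_cpow (d : ℕ) (z : ℂ) {x : ℝ} (hx : 0 < x) :
    HasDerivAt ((fwdDiff 1)^[d] fun t : ℝ => (t : ℂ) ^ z)
      (z * (fwdDiff 1)^[d] (fun t : ℝ => (t : ℂ) ^ (z - 1)) x) x := by
  induction d generalizing x with
  | zero =>
    have h := ((hasDerivAt_id (x : ℂ)).cpow_const (c := z)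
      (Complex.ofReal_mem_slitPlane.2 hx)).comp_ofReal
    simpa using h
  | succ d ih =>
    simp only [Function.iterate_succ_apply']
    have h1 := (ih (x := x + 1) (by linarith)).comp_add_const x 1
    have h := h1.sub (ih hx)
    rw [← mul_sub] at h
    exact h

/-- Each difference gains one power of `x` by the mean value inequality, since differentiation only
turns `z` into `z - 1`. The constant is uniform for bounded `z`, as the later Weierstrass M-test
requires. -/
theorem norm_fwdDiff_iter_cpow_le (d : ℕ) (R : ℝ) : ∃ C : ℝ, 0 ≤ C ∧ ∀ z : ℂ, ‖z‖ ≤ R → z.re ≤ d →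
    ∀ x : ℝ, 1 ≤ x → ‖(fwdDiff 1)^[d] (fun t : ℝ => (t : ℂ) ^ z) x‖ ≤ C * x ^ (z.re - d) := by
  induction d generalizing R with
  | zero =>
    refine ⟨1, zero_le_one, fun z _ _ x hx => ?_⟩
    simp [Complex.norm_cpow_eq_rpow_re_of_pos (lt_of_lt_of_le one_pos hx)]
  | succ d ih =>
    obtain ⟨C, hC, h⟩ := ih (R + 1)
    refine ⟨|R| * C, by positivity, fun z hz hre x hx => ?_⟩
    have hx0 : 0 < x := by linarith
    rw [Function.iterate_succ_apply']
    have key := Convex.norm_image_sub_le_of_norm_hasDerivWithin_le (𝕜 := ℝ) (s := Set.Icc x (x + 1))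
      (x := x) (y := x + 1) (f := (fwdDiff 1)^[d] fun t : ℝ => (t : ℂ) ^ z)
      (f' := fun t => z * (fwdDiff 1)^[d] (fun t : ℝ => (t : ℂ) ^ (z - 1)) t)
      (C := |R| * (C * x ^ (z.re - (d + 1 : ℕ))))
      (fun t ht => (hasDerivAt_fwdDiff_iter_cpow d z (by linarith [ht.1])).hasDerivWithinAt)
      (fun t ht => ?_) (convex_Icc _ _) ⟨le_rfl, by linarith⟩ ⟨by linarith, le_rfl⟩
    · simpa [fwdDiff, mul_assoc] using key
    · have ht0 : 0 < t := by linarith [ht.1]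
      push_cast at hre
      have h1 := h (z - 1) ((norm_sub_le _ _).trans (by simpa using hz))
        (by simpa using (by linarith : z.re ≤ d + 1)) t (by linarith [ht.1])
      rw [norm_mul]
      gcongr
      · exact hz.trans (le_abs_self R)
      · refine h1.trans ?_
        gcongr
        have : (z - 1).re - d = z.re - (d + 1 : ℕ) := by simp; ring
        rw [this]
        -- The exponent is nonpositive by `hre`, so the bound on `[x, x + 1]` is worst at the left
        -- end.
        exact Real.rpow_le_rpow_of_nonpos hx0 ht.1 (by push_cast; linarith)

/-- The sequence `j ↦ j ^ z`. -/
noncomputable def natPow (z : ℂ) (j : ℕ) : ℂ := (j : ℂ) ^ z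

theorem fwdDiff_iter_natPow (d : ℕ) (z : ℂ) (j : ℕ) :
    (fwdDiff 1)^[d] (natPow z) j = (fwdDiff 1)^[d] (fun t : ℝ => (t : ℂ) ^ z) (j : ℝ) := by
  simp [fwdDiff_iter_eq_sum_shift, natPow]

theorem norm_fwdDiff_iter_natPow_le (d : ℕ) (R : ℝ) : ∃ C : ℝ, 0 ≤ C ∧ ∀ z : ℂ, ‖z‖ ≤ R →
    z.re ≤ d - 2 → ∀ j : ℕ,
      ‖(fwdDiff 1)^[d] (natPow z) (j + 1)‖ ≤ C * ((j + 1 : ℕ) : ℝ) ^ (-2 : ℝ) := by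
  obtain ⟨C, hC, h⟩ := norm_fwdDiff_iter_cpow_le d R
  refine ⟨C, hC, fun z hz hre j => ?_⟩
  rw [fwdDiff_iter_natPow]
  have hj : (1 : ℝ) ≤ ((j + 1 : ℕ) : ℝ) := by exact_mod_cast Nat.le_add_left 1 j
  refine (h z hz (by linarith) _ hj).trans ?_
  gcongr
  linarith

theorem tendsto_fwdDiff_iter_natPow {d : ℕ} {z : ℂ} (hz : z.re ≤ d - 2) :
    Tendsto ((fwdDiff 1)^[d] (natPow z)) atTop (𝓝 0) := by
  obtain ⟨C, -, h⟩ := norm_fwdDiff_iter_natPow_le d ‖z‖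
  rw [← tendsto_add_atTop_iff_nat 1]
  refine squeeze_zero_norm (h z le_rfl hz) ?_
  have h1 : Tendsto (fun j : ℕ => (j : ℝ) ^ (-2 : ℝ)) atTop (𝓝 0) :=
    (tendsto_rpow_neg_atTop two_pos).comp tendsto_natCast_atTop_atTop
  simpa using ((tendsto_add_atTop_iff_nat 1).2 h1).const_mul C

/-! ### The regularized alternating sum of powers -/

theorem summable_euler_natPow_bound (C : ℝ) :
    Summable fun j : ℕ => C * ((j + 1 : ℕ) : ℝ) ^ (-2 : ℝ) :=
  ((summable_nat_add_iff 1).2 (Real.summable_nat_rpow.2 (by norm_num : (-2 : ℝ) < -1))).mul_left C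

theorem norm_euler_term_le (d j : ℕ) (w : ℂ) : ‖(-1) ^ (j + 1) * ((-1 / 2) ^ d * w)‖ ≤ ‖w‖ := by
  have : (1 / 2 : ℝ) ^ d ≤ 1 := pow_le_one₀ (by norm_num) (by norm_num)
  simp only [norm_mul, norm_pow, norm_neg, norm_one, one_pow, one_mul, norm_div, RCLike.norm_ofNat]
  exact mul_le_of_le_one_left (norm_nonneg _) this

/-- The limit of the corrected alternating sums of powers. -/
noncomputable def eulerLimit (d : ℕ) (z : ℂ) : ℂ :=
  eulerPartialSum d (natPow z) 1 +
    ∑' j : ℕ, (-1) ^ (j + 1) * ((-1 / 2) ^ d * (fwdDiff 1)^[d] (natPow z) (j + 1))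

theorem tendsto_eulerPartialSum_natPow {d : ℕ} {z : ℂ} (hz : z.re ≤ d - 2) :
    Tendsto (eulerPartialSum d (natPow z)) atTop (𝓝 (eulerLimit d z)) := by
  obtain ⟨C, -, h⟩ := norm_fwdDiff_iter_natPow_le d ‖z‖
  exact tendsto_eulerPartialSum <| Summable.of_norm_bounded (summable_euler_natPow_bound C) fun j =>
    (norm_euler_term_le d j _).trans (h z le_rfl hz j)

theorem differentiable_natPow_succ (j : ℕ) : Differentiable ℂ fun z => natPow z (j + 1) := by
  have : ((j + 1 : ℕ) : ℂ) ≠ 0 := by exact_mod_cast j.succ_ne_zero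
  exact fun z => (differentiableAt_id.const_cpow (Or.inl this))

theorem differentiable_fwdDiff_iter_natPow (d j : ℕ) :
    Differentiable ℂ fun z => (fwdDiff 1)^[d] (natPow z) (j + 1) := by
  simp only [fwdDiff_iter_eq_sum_shift, zsmul_eq_mul]
  refine Differentiable.fun_sum fun i _ => Differentiable.const_mul ?_ _
  have : j + 1 + i • 1 = (j + i) + 1 := by simp; ring
  rw [this]
  exact differentiable_natPow_succ _

theorem differentiableOn_eulerLimit (d : ℕ) :
    DifferentiableOn ℂ (eulerLimit d) {z | z.re < d - 2} := by
  have hopen : IsOpen {z : ℂ | z.re < d - 2} := isOpen_lt Complex.continuous_re continuous_const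
  intro z hz
  obtain ⟨C, -, h⟩ := norm_fwdDiff_iter_natPow_le d (‖z‖ + 1)
  have hW : IsOpen ({z : ℂ | z.re < d - 2} ∩ Metric.ball 0 (‖z‖ + 1)) :=
    hopen.inter Metric.isOpen_ball
  have hzW : z ∈ {z : ℂ | z.re < d - 2} ∩ Metric.ball 0 (‖z‖ + 1) := ⟨hz, by simp⟩
  have h1 : DifferentiableAt ℂ (fun z => eulerPartialSum d (natPow z) 1) z := by
    have : (fun z => eulerPartialSum d (natPow z) 1) = fun z => - ∑ j ∈ Finset.range d,
        (-1 / 2) ^ j / 2 * (fwdDiff 1)^[j] (natPow z) (0 + 1) := by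
      funext z; simp [eulerPartialSum, eulerTransform]
    rw [this]
    exact (Differentiable.fun_sum fun j _ =>
      (differentiable_fwdDiff_iter_natPow j 0).const_mul _).neg z
  have h2 := Complex.differentiableOn_tsum_of_summable_norm
    (F := fun (j : ℕ) z => (-1) ^ (j + 1) * ((-1 / 2) ^ d * (fwdDiff 1)^[d] (natPow z) (j + 1)))
    (summable_euler_natPow_bound C)
    (fun j => (((differentiable_fwdDiff_iter_natPow d j).const_mul _).const_mul _).differentiableOn)
    hW (fun j w hw => (norm_euler_term_le d j _).trans
      (h w (mem_ball_zero_iff.1 hw.2).le (le_of_lt hw.1) j))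
  exact (h1.add (h2.differentiableAt (hW.mem_nhds hzW))).differentiableWithinAt

theorem hasSum_cosZeta_half {s : ℂ} (hs : 1 < s.re) :
    HasSum (fun n : ℕ => (-1) ^ n * natPow (-s) n)
      (HurwitzZeta.cosZeta ((1 / 2 : ℝ) : UnitAddCircle) s) := by
  have h := HurwitzZeta.hasSum_nat_cosZeta (1 / 2) hs
  convert h using 2 with n
  have h1 : 2 * Real.pi * (1 / 2) * n = n * Real.pi := by ring
  rw [h1, Real.cos_nat_mul_pi, natPow, Complex.cpow_neg, div_eq_mul_inv]
  push_cast
  rfl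

theorem natPow_two_mul (z : ℂ) (k : ℕ) : natPow z (2 * k) = 2 ^ z * natPow z k := by
  simpa [natPow] using Complex.natCast_mul_natCast_cpow 2 k z

/-- Splitting into even and odd indices, the alternating series is twice the even part minus the
whole series. -/
theorem cosZeta_half_eq_of_one_lt_re {s : ℂ} (hs : 1 < s.re) :
    HurwitzZeta.cosZeta ((1 / 2 : ℝ) : UnitAddCircle) s = (2 ^ (1 - s) - 1) * riemannZeta s := by
  have ha : HasSum (natPow (-s)) (riemannZeta s) := by
    have hsum := Complex.summable_one_div_nat_cpow.2 hs
    have h := hsum.hasSum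
    rw [← zeta_eq_tsum_one_div_nat_cpow hs] at h
    convert h using 2 with n
    rw [natPow, Complex.cpow_neg, one_div]
  have he : HasSum (fun k => natPow (-s) (2 * k)) (2 ^ (-s) * riemannZeta s) := by
    simp_rw [natPow_two_mul]
    exact ha.mul_left _
  have ho : Summable fun k => natPow (-s) (2 * k + 1) :=
    ha.summable.comp_injective fun a b hab => by simpa using hab
  have h1 := ha.unique (he.even_add_odd ho.hasSum)
  have he' : HasSum (fun k => (-1) ^ (2 * k) * natPow (-s) (2 * k)) (2 ^ (-s) * riemannZeta s) := by
    simpa [pow_mul] using he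
  have ho' : HasSum (fun k => (-1) ^ (2 * k + 1) * natPow (-s) (2 * k + 1))
      (-∑' k, natPow (-s) (2 * k + 1)) := by
    simpa [pow_succ, pow_mul] using ho.hasSum.neg
  have h2 := (hasSum_cosZeta_half hs).unique (he'.even_add_odd
    (f := fun n : ℕ => (-1) ^ n * natPow (-s) n) ho')
  have h3 : (2 : ℂ) ^ (1 - s) = 2 * 2 ^ (-s) := by
    rw [sub_eq_add_neg, Complex.cpow_add _ _ two_ne_zero, Complex.cpow_one]
  rw [h2, h3]
  linear_combination h1

theorem half_ne_zero_unitAddCircle : ((1 / 2 : ℝ) : UnitAddCircle) ≠ 0 := by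
  intro h
  obtain ⟨n, hn⟩ := (AddCircle.coe_eq_zero_iff (1 : ℝ)).1 h
  have h1 : ((2 * n : ℤ) : ℝ) = 1 := by
    push_cast; simp only [zsmul_eq_mul, mul_one] at hn; linarith
  have h2 : 2 * n = 1 := by exact_mod_cast h1
  omega

theorem cosZeta_half_eq {s : ℂ} (hs : s ≠ 1) :
    HurwitzZeta.cosZeta ((1 / 2 : ℝ) : UnitAddCircle) s = (2 ^ (1 - s) - 1) * riemannZeta s := by
  have hopen : IsOpen ({1}ᶜ : Set ℂ) := isOpen_compl_singleton
  refine AnalyticOnNhd.eqOn_of_preconnected_of_eventuallyEq (U := {1}ᶜ) (z₀ := 2)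
    (g := fun s => (2 ^ (1 - s) - 1) * riemannZeta s)
    ((HurwitzZeta.differentiable_cosZeta_of_ne_zero
      half_ne_zero_unitAddCircle).differentiableOn.analyticOnNhd hopen)
    (DifferentiableOn.analyticOnNhd (fun w hw => ?_) hopen)
    (isConnected_compl_singleton_of_one_lt_rank (by simp [Complex.rank_real_complex])
      1).isPreconnected (by norm_num) ?_ hs
  · refine (DifferentiableAt.mul ?_ (differentiableAt_riemannZeta hw)).differentiableWithinAt
    exact ((differentiableAt_id.const_sub 1).const_cpow (Or.inl two_ne_zero)).sub_const 1
  · filter_upwards [(isOpen_lt continuous_const Complex.continuous_re).mem_nhds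
      (show (1 : ℝ) < (2 : ℂ).re by norm_num)] with w hw
    exact cosZeta_half_eq_of_one_lt_re hw

/-- In this half-plane every difference of `j ^ z`, including the zeroth, tends to zero, so the
Euler correction disappears in the limit and the plain series remains. -/
theorem eulerLimit_eq_cosZeta_of_re_lt (d : ℕ) {z : ℂ} (hz : z.re < -2) :
    eulerLimit d z = HurwitzZeta.cosZeta ((1 / 2 : ℝ) : UnitAddCircle) (-z) := by
  have hz0 : z ≠ 0 := by rintro rfl; norm_num at hz
  have hd : (0 : ℝ) ≤ d := d.cast_nonneg
  refine tendsto_nhds_unique (tendsto_eulerPartialSum_natPow (d := d) (by linarith)) ?_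
  have h1 : Tendsto (fun M : ℕ => ∑ j ∈ Finset.Ico 1 M, (-1) ^ j * natPow z j) atTop
      (𝓝 (HurwitzZeta.cosZeta ((1 / 2 : ℝ) : UnitAddCircle) (-z))) := by
    have h := (hasSum_cosZeta_half (s := -z) (by simp; linarith)).tendsto_sum_nat
    refine h.congr' ?_
    filter_upwards [eventually_ge_atTop 1] with M hM
    rw [← Finset.sum_range_add_sum_Ico _ hM]
    simp [natPow, hz0]
  have h2 : Tendsto (eulerTransform d (natPow z)) atTop (𝓝 0) := by
    have : ∀ j ∈ Finset.range d, Tendsto (fun M => (-1 / 2 : ℂ) ^ j / 2 *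
        (fwdDiff 1)^[j] (natPow z) M) atTop (𝓝 0) := fun j _ => by
      have hj : (0 : ℝ) ≤ j := j.cast_nonneg
      simpa using (tendsto_fwdDiff_iter_natPow (d := j) (z := z) (by linarith)).const_mul
        ((-1 / 2 : ℂ) ^ j / 2)
    rw [← Finset.sum_const_zero (s := Finset.range d)]
    exact tendsto_finsetSum _ this
  have h3 : Tendsto (fun M : ℕ => (-1) ^ M * eulerTransform d (natPow z) M) atTop (𝓝 0) :=
    squeeze_zero_norm (a := fun M => ‖eulerTransform d (natPow z) M‖) (fun M => by simp)
      (by simpa using h2.norm)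
  have h4 := h1.add h3
  rw [add_zero] at h4
  exact h4

theorem eulerLimit_eq_cosZeta {d : ℕ} {z : ℂ} (hz : z.re < d - 2) :
    eulerLimit d z = HurwitzZeta.cosZeta ((1 / 2 : ℝ) : UnitAddCircle) (-z) := by
  have hopen : IsOpen {z : ℂ | z.re < d - 2} := isOpen_lt Complex.continuous_re continuous_const
  have hd : (0 : ℝ) ≤ d := d.cast_nonneg
  -- The base point `-3` lies in the half-plane for every `d ≥ 0` and also in the region of the
  -- plain series.
  refine AnalyticOnNhd.eqOn_of_preconnected_of_eventuallyEq (U := {z : ℂ | z.re < d - 2})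
    (z₀ := -3) (g := fun z => HurwitzZeta.cosZeta ((1 / 2 : ℝ) : UnitAddCircle) (-z))
    ((differentiableOn_eulerLimit d).analyticOnNhd hopen)
    (DifferentiableOn.analyticOnNhd (Differentiable.differentiableOn ?_) hopen)
    (convex_halfSpace_re_lt _).isPreconnected ?_ ?_ hz
  · exact (HurwitzZeta.differentiable_cosZeta_of_ne_zero half_ne_zero_unitAddCircle).comp
      differentiable_id.neg
  · simp; linarith
  · filter_upwards [(isOpen_lt Complex.continuous_re continuous_const).mem_nhds
      (show (-3 : ℂ).re < -2 by norm_num)] with w hw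
    exact eulerLimit_eq_cosZeta_of_re_lt d hw

theorem eulerLimit_eq {d : ℕ} {z : ℂ} (hz : z.re < d - 2) (hz1 : z ≠ -1) :
    eulerLimit d z = (2 ^ (1 + z) - 1) * riemannZeta (-z) := by
  rw [eulerLimit_eq_cosZeta hz, cosZeta_half_eq fun h => hz1 (by rw [← h, neg_neg]), sub_neg_eq_add]

/-! ### Fractional sums of polynomials -/

theorem sumPoly_eval_sub_eval (p : ℂ[X]) (x : ℂ) :
    (sumPoly p).eval x - (sumPoly p).eval (x - 1) = p.eval x := by
  have h : (sumPoly p).comp (X + 1) - sumPoly p = p.comp (X + 1) := by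
    refine Polynomial.eq_of_infinite_eval_eq _ _
      ((Set.infinite_range_of_injective (Nat.cast_injective (R := ℂ))).mono ?_)
    rintro _ ⟨n, rfl⟩
    have h1 := sumPoly_eval_nat p (n + 1)
    rw [Finset.sum_Icc_succ_top (by omega), ← sumPoly_eval_nat] at h1
    push_cast at h1
    simp [h1]
  have := congrArg (Polynomial.eval (x - 1)) h
  simpa using this

/-- The fractional sum of a polynomial can be computed with any antidifference. -/
theorem polyFracSum_eq {p P : ℂ[X]} (h : ∀ x, P.eval x - P.eval (x - 1) = p.eval x) (a b : ℂ) :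
    polyFracSum p a b = P.eval b - P.eval (a - 1) := by
  have h1 : P - C (P.eval 0) = sumPoly p := by
    refine (existsUnique_sumPoly p).unique (fun n => ?_) (sumPoly_eval_nat p)
    induction n with
    | zero => simp
    | succ n ih =>
      rw [Finset.sum_Icc_succ_top (by omega), ← ih, ← h]
      simp
  simp [polyFracSum, ← h1]

theorem polyFracSum_taylor (p : ℂ[X]) (c a b : ℂ) :
    polyFracSum (taylor c p) a b = polyFracSum p (a + c) (b + c) := by
  rw [polyFracSum_eq (P := taylor c (sumPoly p)) (fun x => ?_), polyFracSum, taylor_eval,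
    taylor_eval]
  · congr 2; ring
  · have h : x - 1 + c = x + c - 1 := by ring
    rw [taylor_eval, taylor_eval, taylor_eval, h, sumPoly_eval_sub_eval]

theorem polyFracSum_sub (p q : ℂ[X]) (a b : ℂ) :
    polyFracSum (p - q) a b = polyFracSum p a b - polyFracSum q a b := by
  rw [polyFracSum_eq (P := sumPoly p - sumPoly q) (fun x => ?_), polyFracSum, polyFracSum]
  · simp; ring
  · rw [eval_sub, eval_sub, eval_sub, ← sumPoly_eval_sub_eval p, ← sumPoly_eval_sub_eval q]; ring

theorem polyFracSum_sum_C_mul {ι : Type*} (s : Finset ι) (c : ι → ℂ) (q : ι → ℂ[X]) (a b : ℂ) :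
    polyFracSum (∑ i ∈ s, C (c i) * q i) a b = ∑ i ∈ s, c i * polyFracSum (q i) a b := by
  rw [polyFracSum_eq (P := ∑ i ∈ s, C (c i) * sumPoly (q i)) (fun x => ?_)]
  · simp [eval_finsetSum, ← Finset.sum_sub_distrib, polyFracSum, mul_sub]
  · simp only [eval_finsetSum, eval_mul, eval_C, ← Finset.sum_sub_distrib, ← mul_sub,
      sumPoly_eval_sub_eval]

/-- If the polynomials `r n (n + ·)` have bounded degree and tend to zero at infinitely many
points, then their fractional sums tend to zero. -/
theorem tendsto_polyFracSum_zero {l : Filter ℤ} {r : ℤ → ℂ[X]} {D : ℕ}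
    (hr : ∀ n, (r n).degree < D) {x : ℕ → ℂ} (hx : Function.Injective x)
    (h : ∀ i, Tendsto (fun n : ℤ => (r n).eval (n + x i)) l (𝓝 0)) (a b : ℂ) :
    Tendsto (fun n : ℤ => polyFracSum (r n) (n + a) (n + b)) l (𝓝 0) := by
  have key : ∀ n : ℤ, polyFracSum (r n) (n + a) (n + b) = ∑ i ∈ Finset.range D,
      (r n).eval (n + x i) * polyFracSum (Lagrange.basis (Finset.range D) x i) a b := by
    intro n
    -- After translation by `n` the nodes `x i` are fixed, so the weights of the values do not
    -- depend on `n`.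
    have hs := Lagrange.eq_interpolate (s := Finset.range D) (v := x) (f := taylor (n : ℂ) (r n))
      hx.injOn (by simpa using hr n)
    rw [add_comm, add_comm _ b, ← polyFracSum_taylor, hs, Lagrange.interpolate_apply,
      polyFracSum_sum_C_mul]
    simp [taylor_eval, add_comm]
  simp_rw [key]
  rw [← Finset.sum_const_zero (s := Finset.range D)]
  exact tendsto_finsetSum _ fun i _ => by simpa using (h i).mul_const _

/-! ### Sums over integer ranges -/

theorem intSum_zero (g : ℤ → ℂ) : intSum g 0 = 0 := by simp [intSum]

theorem intSum_add_one (g : ℤ → ℂ) (n : ℤ) : intSum g (n + 1) = intSum g n + g (n + 1) := by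
  rcases le_or_gt 0 n with hn | hn
  · have h1 : Finset.Ioc 0 (n + 1) = insert (n + 1) (Finset.Ioc 0 n) := by
      ext; simp; omega
    have h2 : Finset.Ioc (n + 1) 0 = ∅ := Finset.Ioc_eq_empty (by omega)
    have h3 : Finset.Ioc n 0 = ∅ := Finset.Ioc_eq_empty (by omega)
    rw [intSum, intSum, h1, h2, h3, Finset.sum_insert (by simp)]
    simp; ring
  · have h1 : Finset.Ioc n 0 = insert (n + 1) (Finset.Ioc (n + 1) 0) := by
      ext; simp; omega
    have h2 : Finset.Ioc 0 (n + 1) = ∅ := Finset.Ioc_eq_empty (by omega)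
    have h3 : Finset.Ioc 0 n = ∅ := Finset.Ioc_eq_empty (by omega)
    rw [intSum, intSum, h1, h2, h3, Finset.sum_insert (by simp)]
    simp

theorem intSum_shift_sub (g : ℤ → ℂ) (n : ℤ) :
    intSum (fun ν => g (ν + 1)) n - intSum g n = g (n + 1) - g 1 := by
  induction n using Int.induction_on with
  | zero => simp [intSum_zero]
  | succ n ih => rw [intSum_add_one, intSum_add_one]; linear_combination ih
  | pred n ih =>
    have h1 := intSum_add_one (fun ν => g (ν + 1)) (-n - 1)
    have h2 := intSum_add_one g (-n - 1)
    simp only [sub_add_cancel] at *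
    linear_combination ih - h1 + h2

theorem intSum_sub (g h : ℤ → ℂ) (n : ℤ) :
    intSum (fun ν => g ν - h ν) n = intSum g n - intSum h n := by
  simp only [intSum, Finset.sum_sub_distrib]; ring

/-! ### Existence and uniqueness of fractional sums -/

/-- The contribution of one of the two end points to `fracSumApprox`. -/
noncomputable def endPointApprox (f : ℂ → ℂ) (p : ℤ → ℂ[X]) (x : ℂ) (n : ℤ) : ℂ :=
  (sumPoly (p n)).eval (n + x - 1) - intSum (fun ν => f (ν + x - 1)) n

theorem fracSumApprox_eq (f : ℂ → ℂ) (p : ℤ → ℂ[X]) (a b : ℂ) (n : ℤ) :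
    fracSumApprox f p a b n = endPointApprox f p (b + 1) n - endPointApprox f p a n := by
  have h : ∀ ν : ℤ, (ν : ℂ) + (b + 1) - 1 = ν + b := fun ν => by ring
  simp only [fracSumApprox, endPointApprox, intSum_sub, polyFracSum, h]
  ring

/-- Both the polynomial part and the sum telescope. Hence the approximation property alone relates
`x` to `x + 1`. -/
theorem endPointApprox_add_one (f : ℂ → ℂ) (p : ℤ → ℂ[X]) (x : ℂ) (n : ℤ) :
    endPointApprox f p (x + 1) n - endPointApprox f p x n =
      f x - (f (n + x) - (p n).eval (n + x)) := by
  have h := intSum_shift_sub (fun ν => f (ν + x - 1)) n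
  have h1 : ∀ ν : ℤ, (ν : ℂ) + (x + 1) - 1 = ν + x := fun ν => by ring
  have h2 : ∀ ν : ℤ, ((ν + 1 : ℤ) : ℂ) + x - 1 = ν + x := fun ν => by push_cast; ring
  have h3 : ((1 : ℤ) : ℂ) + x - 1 = x := by push_cast; ring
  simp only [h2, h3] at h
  have h4 := sumPoly_eval_sub_eval (p n) (n + x)
  simp only [endPointApprox, h1]
  linear_combination h4 - h

/-- Two points are related when the corresponding end point contributions differ asymptotically by
a constant. -/
def EndPointRel (l : Filter ℤ) (f : ℂ → ℂ) (p : ℤ → ℂ[X]) (x y : ℂ) : Prop :=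
  ∃ s : ℂ, Tendsto (fun n => endPointApprox f p y n - endPointApprox f p x n) l (𝓝 s)

namespace EndPointRel

variable {l : Filter ℤ} {f : ℂ → ℂ} {p : ℤ → ℂ[X]} {x y w : ℂ}

theorem refl (x : ℂ) : EndPointRel l f p x x := ⟨0, by simpa using tendsto_const_nhds⟩

theorem symm (h : EndPointRel l f p x y) : EndPointRel l f p y x := by
  obtain ⟨s, hs⟩ := h
  exact ⟨-s, by simpa using hs.neg⟩

theorem trans (h : EndPointRel l f p x y) (h' : EndPointRel l f p y w) :
    EndPointRel l f p x w := by
  obtain ⟨s, hs⟩ := h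
  obtain ⟨t, ht⟩ := h'
  exact ⟨t + s, by simpa using ht.add hs⟩

theorem add_one (h : Tendsto (fun n : ℤ => ‖f (n + x) - (p n).eval (n + x)‖) l (𝓝 0)) :
    EndPointRel l f p x (x + 1) := by
  refine ⟨f x, ?_⟩
  simp_rw [endPointApprox_add_one]
  simpa using (tendsto_zero_iff_norm_tendsto_zero.2 h).const_sub (f x)

end EndPointRel

/-- The fractional sum does not depend on the approximating polynomials. -/
theorem tendsto_fracSumApprox_congr {l : Filter ℤ} {f : ℂ → ℂ} {p q : ℤ → ℂ[X]} {D : ℕ}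
    (hp : ∀ n, (p n).degree < D) (hq : ∀ n, (q n).degree < D) {x : ℕ → ℂ}
    (hx : Function.Injective x)
    (hfp : ∀ i, Tendsto (fun n : ℤ => ‖f (n + x i) - (p n).eval (n + x i)‖) l (𝓝 0))
    (hfq : ∀ i, Tendsto (fun n : ℤ => ‖f (n + x i) - (q n).eval (n + x i)‖) l (𝓝 0))
    {a b s : ℂ} (h : Tendsto (fracSumApprox f p a b) l (𝓝 s)) :
    Tendsto (fracSumApprox f q a b) l (𝓝 s) := by
  have h0 := tendsto_polyFracSum_zero (l := l) (r := fun n => q n - p n) (D := D)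
    (fun n => (degree_sub_le _ _).trans_lt (max_lt (hq n) (hp n))) hx (fun i => by
      have := (tendsto_zero_iff_norm_tendsto_zero.2 (hfp i)).sub
        (tendsto_zero_iff_norm_tendsto_zero.2 (hfq i))
      simpa using this) a b
  have := h0.add h
  rw [zero_add] at this
  refine this.congr fun n => ?_
  rw [polyFracSum_sub, fracSumApprox, fracSumApprox]
  ring

theorem exists_degree_lt {σ τ : WithBot ℕ} : ∃ D : ℕ, σ < D ∧ τ < D := by
  induction σ using WithBot.recBotCoe <;> induction τ using WithBot.recBotCoe
  · exact ⟨0, WithBot.bot_lt_coe _, WithBot.bot_lt_coe _⟩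
  · rename_i t; exact ⟨t + 1, WithBot.bot_lt_coe _, WithBot.coe_lt_coe.2 (Nat.lt_succ_self _)⟩
  · rename_i t; exact ⟨t + 1, WithBot.coe_lt_coe.2 (Nat.lt_succ_self _), WithBot.bot_lt_coe _⟩
  · rename_i t u
    exact ⟨t + u + 1, WithBot.coe_lt_coe.2 (Nat.lt_succ_of_le (Nat.le_add_right t u)),
      WithBot.coe_lt_coe.2 (Nat.lt_succ_of_le (Nat.le_add_left u t))⟩

theorem HasRightFracSum.unique {f : ℂ → ℂ} {a b s t : ℂ} (hs : HasRightFracSum f a b s)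
    (ht : HasRightFracSum f a b t) : s = t := by
  obtain ⟨U, σ, p, ⟨⟨hU, hpσ, hp⟩, -⟩, haU, -, hps⟩ := hs
  obtain ⟨V, τ, q, ⟨⟨hV, hqτ, hq⟩, -⟩, haV, -, hqt⟩ := ht
  obtain ⟨D, hσ, hτ⟩ := exists_degree_lt (σ := σ) (τ := τ)
  -- The points `a + i` lie in both domains, so they can test both families of polynomials.
  have mem : ∀ W : Set ℂ, (∀ u ∈ W, u + 1 ∈ W) → a ∈ W → ∀ i : ℕ, a + i ∈ W := by
    intro W hW ha i
    induction i with
    | zero => simpa using ha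
    | succ i ih => push_cast; rw [← add_assoc]; exact hW _ ih
  refine tendsto_nhds_unique (tendsto_fracSumApprox_congr (D := D) (fun n => by rwa [hpσ])
    (fun n => by rwa [hqτ]) (x := fun i : ℕ => a + i)
    (fun i j hij => by simpa using hij) (fun i => hp _ (mem U hU haU i))
    (fun i => hq _ (mem V hV haV i)) hps) hqt

theorem HasLeftFracSum.unique {f : ℂ → ℂ} {a b s t : ℂ} (hs : HasLeftFracSum f a b s)
    (ht : HasLeftFracSum f a b t) : s = t := by
  obtain ⟨U, σ, p, ⟨⟨hU, hpσ, hp⟩, -⟩, haU, -, hps⟩ := hs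
  obtain ⟨V, τ, q, ⟨⟨hV, hqτ, hq⟩, -⟩, haV, -, hqt⟩ := ht
  obtain ⟨D, hσ, hτ⟩ := exists_degree_lt (σ := σ) (τ := τ)
  have mem : ∀ W : Set ℂ, (∀ u ∈ W, u - 1 ∈ W) → a ∈ W → ∀ i : ℕ, a - i ∈ W := by
    intro W hW ha i
    induction i with
    | zero => simpa using ha
    | succ i ih => push_cast; rw [← sub_sub]; exact hW _ ih
  refine tendsto_nhds_unique (tendsto_fracSumApprox_congr (D := D) (fun n => by rwa [hpσ])
    (fun n => by rwa [hqτ]) (x := fun i : ℕ => a - i)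
    (fun i j hij => by simpa using hij) (fun i => hp _ (mem U hU haU i))
    (fun i => hq _ (mem V hV haV i)) hps) hqt

theorem HasRightFracSum.rightFracSum_eq {f : ℂ → ℂ} {a b s : ℂ} (hs : HasRightFracSum f a b s) :
    rightFracSum f a b = s := by
  have h : ∃ s, HasRightFracSum f a b s := ⟨s, hs⟩
  rw [rightFracSum, dif_pos h]
  exact h.choose_spec.unique hs

theorem HasLeftFracSum.leftFracSum_eq {f : ℂ → ℂ} {a b s : ℂ} (hs : HasLeftFracSum f a b s) :
    leftFracSum f a b = s := by
  have h : ∃ s, HasLeftFracSum f a b s := ⟨s, hs⟩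
  rw [leftFracSum, dif_pos h]
  exact h.choose_spec.unique hs

/-- Approximating polynomials of degree less than `d` can be changed into approximating polynomials
of degree exactly `d`. -/
theorem exists_degree_eq {l : Filter ℤ} (hl : Tendsto (fun n : ℤ => |(n : ℝ)|) l atTop)
    {p : ℤ → ℂ[X]} {d : ℕ} (hp : ∀ n, (p n).degree < d) :
    ∃ q : ℤ → ℂ[X], (∀ n, (q n).degree = (d : WithBot ℕ)) ∧ ∀ (f : ℂ → ℂ) (x : ℂ),
      Tendsto (fun n : ℤ => ‖f (n + x) - (p n).eval (n + x)‖) l (𝓝 0) →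
      Tendsto (fun n : ℤ => ‖f (n + x) - (q n).eval (n + x)‖) l (𝓝 0) := by
  have hpos : ∀ n : ℤ, (0 : ℝ) < |(n : ℝ)| + 1 := fun n => by positivity
  have hc : ∀ n : ℤ, (((|(n : ℝ)| + 1)⁻¹ : ℝ) : ℂ) ≠ 0 := fun n => by
    exact_mod_cast (inv_pos.2 (hpos n)).ne'
  have hdeg : ∀ n : ℤ, (C (((|(n : ℝ)| + 1)⁻¹ : ℝ) : ℂ) * (X - C (n : ℂ)) ^ d : ℂ[X]).degree =
      (d : WithBot ℕ) := by
    intro n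
    rw [degree_C_mul (hc n), degree_pow, degree_X_sub_C]
    simp
  -- The added term has degree exactly `d`, but at `n + x` it equals `x ^ d / (|n| + 1)`, which
  -- tends to zero.
  refine ⟨fun n => p n + C (((|(n : ℝ)| + 1)⁻¹ : ℝ) : ℂ) * (X - C (n : ℂ)) ^ d, fun n => ?_,
    fun f x hx => ?_⟩
  · rw [degree_add_eq_right_of_degree_lt (by rw [hdeg]; exact hp n), hdeg]
  · have h1 : Tendsto (fun n : ℤ => (((|(n : ℝ)| + 1)⁻¹ : ℝ) : ℂ)) l (𝓝 0) := by
      have := (tendsto_inv_atTop_zero.comp (tendsto_atTop_add_const_right l (1 : ℝ) hl))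
      exact (Complex.continuous_ofReal.tendsto' 0 0 (by simp)).comp this
    rw [← tendsto_zero_iff_norm_tendsto_zero] at hx ⊢
    have := hx.sub (h1.mul_const (x ^ d))
    rw [zero_mul, sub_zero] at this
    refine this.congr fun n => ?_
    simp; ring

/-! ### Interpolation on arithmetic progressions -/

theorem fwdDiff_iter_eval_eq_zero {p : ℂ[X]} {d : ℕ} (hp : p.natDegree < d) (y c : ℂ) {j : ℕ}
    (hj : d ≤ j) : (fwdDiff 1)^[j] (fun k : ℕ => p.eval (y + c * k)) = 0 := by
  have hq : (p.comp (C c * X + C y)).natDegree < j := by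
    refine lt_of_le_of_lt natDegree_comp_le (lt_of_le_of_lt ?_ (hp.trans_le hj))
    exact (Nat.mul_le_mul_left _ (natDegree_linear_le (a := c) (b := y))).trans (mul_one _).le
  funext k
  have h := congrFun (Polynomial.fwdDiff_iter_eq_zero_of_degree_lt hq) (k : ℂ)
  rw [fwdDiff_iter_eq_sum_shift] at h ⊢
  simpa [add_comm y] using h

theorem natDegree_lt_of_degree_lt {p : ℂ[X]} {d : ℕ} (hd : 0 < d) (hp : p.degree < d) :
    p.natDegree < d := by
  by_cases h : p = 0
  · simpa [h] using hd
  · exact (natDegree_lt_iff_degree_lt h).2 hp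

theorem polyFracSum_eq_eulerTransform {p : ℂ[X]} {d : ℕ} (hd : 0 < d) (hp : p.degree < d) (n : ℂ) :
    polyFracSum p (n + 1) (n + -1 / 2) =
      -eulerTransform d (fun k => p.eval (n + (1 / 2 + 1 / 2 * k))) 0 := by
  have key := eq_eulerTransform
    (κ := fun k => (sumPoly p).eval (n + 1 / 2 * k) - (sumPoly p).eval (n - 1 / 2 + 1 / 2 * k))
    (ψ := fun k => p.eval (n + (1 / 2 + 1 / 2 * k))) (d := d) (e := (sumPoly p).natDegree + 1)
    (fun k => ?_) (fun j hj => ?_) (fun j hj => ?_) 0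
  · rw [← key, polyFracSum]
    have h : n + -1 / 2 = n - 1 / 2 := by ring
    simp [h]
  · have h := sumPoly_eval_sub_eval p (n + (1 / 2 + 1 / 2 * k))
    have h1 : n + 1 / 2 * ((k + 1 : ℕ) : ℂ) = n + (1 / 2 + 1 / 2 * k) := by push_cast; ring
    have h2 : n - 1 / 2 + 1 / 2 * ((k + 1 : ℕ) : ℂ) = n + 1 / 2 * k := by push_cast; ring
    have h3 : n + (1 / 2 + 1 / 2 * k) - 1 = n - 1 / 2 + 1 / 2 * k := by ring
    rw [h3] at h
    simp only [h1, h2]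
    linear_combination h
  · have h1 := fwdDiff_iter_eval_eq_zero (Nat.lt_succ_self _) n (1 / 2) hj
    have h2 := fwdDiff_iter_eval_eq_zero (Nat.lt_succ_self _) (n - 1 / 2) (1 / 2) hj
    have h3 : (fun k : ℕ => (sumPoly p).eval (n + 1 / 2 * k) -
        (sumPoly p).eval (n - 1 / 2 + 1 / 2 * k)) =
        (fun k : ℕ => (sumPoly p).eval (n + 1 / 2 * k)) + (-1 : ℂ) •
          (fun k : ℕ => (sumPoly p).eval (n - 1 / 2 + 1 / 2 * k)) := by
      funext k; simp [sub_eq_add_neg]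
    rw [h3, fwdDiff_iter_add, fwdDiff_iter_const_smul, h1, h2]
    simp
  · simpa [add_assoc] using
      fwdDiff_iter_eval_eq_zero (natDegree_lt_of_degree_lt hd hp) (n + 1 / 2) (1 / 2) hj

/-- Here the progression runs to the left, so that for `n → -∞` it moves away from the origin. The
two extra values come from moving both arguments of the antidifference up by one. -/
theorem polyFracSum_eq_eulerTransform_neg {p : ℂ[X]} {d : ℕ} (hd : 0 < d) (hp : p.degree < d)
    (n : ℂ) : polyFracSum p (n + 1) (n + -1 / 2) = p.eval (n + 1) - p.eval (n + 1 / 2) -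
      eulerTransform d (fun k => p.eval (n + (1 + -1 / 2 * k))) 0 := by
  have key := eq_eulerTransform
    (κ := fun k => (sumPoly p).eval (n + 1 + -1 / 2 * k) - (sumPoly p).eval (n + 1 / 2 + -1 / 2 * k))
    (ψ := fun k => p.eval (n + (1 + -1 / 2 * k))) (d := d) (e := (sumPoly p).natDegree + 1)
    (fun k => ?_) (fun j hj => ?_) (fun j hj => ?_) 0
  · rw [← key, polyFracSum, ← sumPoly_eval_sub_eval p (n + 1), ← sumPoly_eval_sub_eval p (n + 1 / 2)]
    have h : n + 1 / 2 - 1 = n + -1 / 2 := by ring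
    rw [h]
    simp
    ring
  · have h := sumPoly_eval_sub_eval p (n + (1 + -1 / 2 * k))
    have h1 : n + 1 + -1 / 2 * ((k + 1 : ℕ) : ℂ) = n + 1 / 2 + -1 / 2 * k := by push_cast; ring
    have h2 : n + 1 / 2 + -1 / 2 * ((k + 1 : ℕ) : ℂ) = n + (1 + -1 / 2 * k) - 1 := by
      push_cast; ring
    have h3 : n + 1 + -1 / 2 * (k : ℂ) = n + (1 + -1 / 2 * k) := by ring
    simp only [h1, h2, h3]
    linear_combination h
  · have h1 := fwdDiff_iter_eval_eq_zero (Nat.lt_succ_self _) (n + 1) (-1 / 2) hj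
    have h2 := fwdDiff_iter_eval_eq_zero (Nat.lt_succ_self _) (n + 1 / 2) (-1 / 2) hj
    have h3 : (fun k : ℕ => (sumPoly p).eval (n + 1 + -1 / 2 * k) -
        (sumPoly p).eval (n + 1 / 2 + -1 / 2 * k)) =
        (fun k : ℕ => (sumPoly p).eval (n + 1 + -1 / 2 * k)) + (-1 : ℂ) •
          (fun k : ℕ => (sumPoly p).eval (n + 1 / 2 + -1 / 2 * k)) := by
      funext k; simp [sub_eq_add_neg]
    rw [h3, fwdDiff_iter_add, fwdDiff_iter_const_smul, h1, h2]
    simp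
  · simpa [add_assoc] using
      fwdDiff_iter_eval_eq_zero (natDegree_lt_of_degree_lt hd hp) (n + 1) (-1 / 2) hj

theorem injective_affine {x₀ c : ℂ} (hc : c ≠ 0) :
    Function.Injective fun k : ℕ => x₀ + c * k := fun i j hij => by
  simpa [hc] using hij

/-- A function that agrees near infinity with a multiple of `j ↦ j ^ z` on an arithmetic progression
has approximating polynomials there, obtained by interpolation. -/
theorem exists_interpolating_approxPoly {l : Filter ℤ} {f : ℂ → ℂ} {z : ℂ} {d : ℕ} {x₀ c A : ℂ}
    {M : ℤ → ℕ} (hc : c ≠ 0) (hd : 0 < d) (hz : z.re ≤ d - 2) (hM : Tendsto M l atTop)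
    (h : ∀ᶠ n : ℤ in l, ∀ k : ℕ, f (n + (x₀ + c * k)) = A * natPow z (M n + k)) :
    ∃ p : ℤ → ℂ[X], (∀ n, (p n).degree < d) ∧
      (∀ n : ℤ, ∀ k : ℕ, k < d → (p n).eval (n + (x₀ + c * k)) = f (n + (x₀ + c * k))) ∧
      ∀ k : ℕ, Tendsto (fun n : ℤ => ‖f (n + (x₀ + c * k)) - (p n).eval (n + (x₀ + c * k))‖)
        l (𝓝 0) := by
  have hinj : ∀ n : ℤ, Set.InjOn (fun k : ℕ => (n : ℂ) + (x₀ + c * k)) (Finset.range d) :=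
    fun n i _ j _ hij => injective_affine hc (add_left_cancel hij)
  set p : ℤ → ℂ[X] := fun n => Lagrange.interpolate (Finset.range d)
    (fun k : ℕ => (n : ℂ) + (x₀ + c * k)) fun k : ℕ => f (n + (x₀ + c * k)) with hp
  have hdeg : ∀ n, (p n).degree < d := fun n => by
    have := Lagrange.degree_interpolate_lt (fun k : ℕ => f (n + (x₀ + c * k))) (hinj n)
    rwa [Finset.card_range] at this
  have hval : ∀ n : ℤ, ∀ k : ℕ, k < d →
      (p n).eval (n + (x₀ + c * k)) = f (n + (x₀ + c * k)) := fun n k hk =>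
    Lagrange.eval_interpolate_at_node (fun k : ℕ => f (n + (x₀ + c * k))) (hinj n)
      (Finset.mem_range.2 hk)
  refine ⟨p, hdeg, hval, fun k => ?_⟩
  rw [← tendsto_zero_iff_norm_tendsto_zero]
  -- By Newton's forward formula it suffices to compare differences at `0`. Those of order below `d`
  -- agree by interpolation; from order `d` on, those of the polynomial vanish and those of the
  -- power tend to zero.
  have hdiff : ∀ j, Tendsto (fun n : ℤ =>
      (fwdDiff 1)^[j] (fun k : ℕ => f (n + (x₀ + c * k))) 0 -
        (fwdDiff 1)^[j] (fun k : ℕ => (p n).eval (n + (x₀ + c * k))) 0) l (𝓝 0) := by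
    intro j
    rcases lt_or_ge j d with hj | hj
    · refine tendsto_const_nhds.congr fun n => ?_
      rw [fwdDiff_iter_congr_zero (m := 0) (ψ := fun k : ℕ => f (n + (x₀ + c * k)))
        (φ := fun k : ℕ => (p n).eval (n + (x₀ + c * k)))
        fun i hi => by simpa using hval n i (by omega), sub_self]
    · have hzj : z.re ≤ j - 2 := hz.trans (by gcongr)
      have h1 := ((tendsto_fwdDiff_iter_natPow hzj).comp hM).const_mul A
      rw [mul_zero] at h1
      refine h1.congr' ?_
      filter_upwards [h] with n hn
      have h2 : (fwdDiff 1)^[j] (fun k : ℕ => (p n).eval (n + (x₀ + c * k))) = 0 := by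
        simpa [add_assoc] using
          fwdDiff_iter_eval_eq_zero (natDegree_lt_of_degree_lt hd (hdeg n)) (n + x₀) c hj
      rw [h2, fwdDiff_iter_congr_zero (m := M n) (ψ := A • natPow z)
        fun i _ => by simpa using hn i, fwdDiff_iter_const_smul]
      simp
  have hsum := tendsto_finsetSum (Finset.range (k + 1))
    fun j _ => (hdiff j).const_mul (k.choose j : ℂ)
  simp only [mul_zero, Finset.sum_const_zero] at hsum
  refine hsum.congr fun n => ?_
  have e1 := shift_eq_sum_fwdDiff_iter 1 (fun k : ℕ => f (n + (x₀ + c * k))) k 0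
  have e2 := shift_eq_sum_fwdDiff_iter 1 (fun k : ℕ => (p n).eval (n + (x₀ + c * k))) k 0
  simp only [smul_eq_mul, mul_one, zero_add, nsmul_eq_mul] at e1 e2
  rw [e1, e2, ← Finset.sum_sub_distrib]
  exact Finset.sum_congr rfl fun j _ => mul_sub _ _ _

/-- On a half-integer progression, unit steps link points of equal parity; a single limit linking
the two classes then gives summability for all end points. -/
theorem EndPointRel.of_step_two {l : Filter ℤ} {f : ℂ → ℂ} {p : ℤ → ℂ[X]} {x : ℕ → ℂ}
    (h01 : EndPointRel l f p (x 0) (x 1)) (h : ∀ k, EndPointRel l f p (x k) (x (k + 2)))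
    (i j : ℕ) : EndPointRel l f p (x i) (x j) := by
  have h0 : ∀ k, EndPointRel l f p (x 0) (x k) := fun k => by
    induction k using Nat.twoStepInduction with
    | zero => exact EndPointRel.refl _
    | one => exact h01
    | more k ih _ => exact ih.trans (h k)
  exact (h0 i).symm.trans (h0 j)

theorem EndPointRel.exists_tendsto {l : Filter ℤ} {f : ℂ → ℂ} {p : ℤ → ℂ[X]} {a b : ℂ}
    (h : EndPointRel l f p a (b + 1)) : ∃ s, Tendsto (fracSumApprox f p a b) l (𝓝 s) := by
  obtain ⟨s, hs⟩ := h
  exact ⟨s, hs.congr fun n => (fracSumApprox_eq f p a b n).symm⟩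

theorem EndPointRel.of_tendsto {l : Filter ℤ} {f : ℂ → ℂ} {p : ℤ → ℂ[X]} {a b s : ℂ}
    (h : Tendsto (fracSumApprox f p a b) l (𝓝 s)) : EndPointRel l f p a (b + 1) :=
  ⟨s, h.congr fun n => fracSumApprox_eq f p a b n⟩

theorem hasRightFracSum_of_tendsto {f : ℂ → ℂ} {p : ℤ → ℂ[X]} {d : ℕ}
    (hp : ∀ n, (p n).degree < d)
    (hf : ∀ k : ℕ, Tendsto (fun n : ℤ => ‖f ((n : ℂ) + (1 / 2 + 1 / 2 * k)) -
      (p n).eval ((n : ℂ) + (1 / 2 + 1 / 2 * k))‖) atTop (𝓝 0)) {s : ℂ}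
    (hs : Tendsto (fracSumApprox f p 1 (-1 / 2)) atTop (𝓝 s)) :
    HasRightFracSum f 1 (-1 / 2) s := by
  obtain ⟨q, hq, hfq⟩ := exists_degree_eq
    (tendsto_abs_atTop_atTop.comp (tendsto_intCast_atTop_atTop (R := ℝ))) hp
  set x : ℕ → ℂ := fun k => 1 / 2 + 1 / 2 * k with hx
  have hqx := fun k => hfq f (x k) (hf k)
  -- The bound `d + 1` covers both `p`, of degree below `d`, and `q`, of degree exactly `d`.
  have hlt : (d : WithBot ℕ) < ((d + 1 : ℕ) : WithBot ℕ) := WithBot.coe_lt_coe.2 d.lt_succ_self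
  have hqs : Tendsto (fracSumApprox f q 1 (-1 / 2)) atTop (𝓝 s) :=
    tendsto_fracSumApprox_congr (D := d + 1) (fun n => (hp n).trans hlt)
      (fun n => by rw [hq]; exact hlt) (injective_affine (by norm_num)) hf hqx hs
  have hx1 : x 1 = 1 := by norm_num [hx]
  have hx0 : x 0 = -1 / 2 + 1 := by norm_num [hx]
  have hstep : ∀ k, x k + 1 = x (k + 2) := fun k => by simp [hx]; ring
  have hrel := EndPointRel.of_step_two (l := atTop) (f := f) (p := q) (x := x)
    (by rw [hx0, hx1]; exact (EndPointRel.of_tendsto hqs).symm)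
    (fun k => by rw [← hstep]; exact EndPointRel.add_one (hqx k))
  refine ⟨Set.range x, d, q, ⟨⟨?_, hq, ?_⟩, ?_⟩, ⟨1, hx1⟩, ⟨0, hx0⟩, hqs⟩
  · rintro _ ⟨k, rfl⟩
    exact ⟨k + 2, (hstep k).symm⟩
  · rintro _ ⟨k, rfl⟩
    exact hqx k
  · rintro _ b ⟨i, rfl⟩ ⟨j, hj⟩
    exact (hj ▸ hrel i j).exists_tendsto

theorem hasLeftFracSum_of_tendsto {f : ℂ → ℂ} {p : ℤ → ℂ[X]} {d : ℕ}
    (hp : ∀ n, (p n).degree < d)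
    (hf : ∀ k : ℕ, Tendsto (fun n : ℤ => ‖f ((n : ℂ) + (1 + -1 / 2 * k)) -
      (p n).eval ((n : ℂ) + (1 + -1 / 2 * k))‖) atBot (𝓝 0)) {s : ℂ}
    (hs : Tendsto (fracSumApprox f p 1 (-1 / 2)) atBot (𝓝 s)) :
    HasLeftFracSum f 1 (-1 / 2) s := by
  obtain ⟨q, hq, hfq⟩ := exists_degree_eq
    (tendsto_abs_atBot_atTop.comp ((tendsto_intCast_atBot_iff (R := ℝ)).2 tendsto_id)) hp
  set x : ℕ → ℂ := fun k => 1 + -1 / 2 * k with hx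
  have hqx := fun k => hfq f (x k) (hf k)
  have hlt : (d : WithBot ℕ) < ((d + 1 : ℕ) : WithBot ℕ) := WithBot.coe_lt_coe.2 d.lt_succ_self
  have hqs : Tendsto (fracSumApprox f q 1 (-1 / 2)) atBot (𝓝 s) :=
    tendsto_fracSumApprox_congr (D := d + 1) (fun n => (hp n).trans hlt)
      (fun n => by rw [hq]; exact hlt) (injective_affine (by norm_num)) hf hqx hs
  have hx0 : x 0 = 1 := by norm_num [hx]
  have hx1 : x 1 = -1 / 2 + 1 := by norm_num [hx]
  have hstep : ∀ k, x (k + 2) + 1 = x k := fun k => by simp [hx]; ring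
  have hrel := EndPointRel.of_step_two (l := atBot) (f := f) (p := q) (x := x)
    (by rw [hx0, hx1]; exact EndPointRel.of_tendsto hqs)
    (fun k => by rw [← hstep]; exact (EndPointRel.add_one (hqx (k + 2))).symm)
  refine ⟨Set.range x, d, q, ⟨⟨?_, hq, ?_⟩, ?_⟩, ⟨0, hx0⟩, ⟨1, hx1⟩, hqs⟩
  · rintro _ ⟨k, rfl⟩
    exact ⟨k + 2, eq_sub_of_add_eq (hstep k)⟩
  · rintro _ ⟨k, rfl⟩
    exact hqx k
  · rintro _ b ⟨i, rfl⟩ ⟨j, hj⟩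
    exact (hj ▸ hrel i j).exists_tendsto

/-! ### Fractional sums of powers -/

theorem powerFn_half {m : ℕ} (hm : m ≠ 0) (z : ℂ) :
    powerFn z (m / 2) = 2 ^ (-z) * natPow z m := by
  have hm' : (m : ℂ) ≠ 0 := by exact_mod_cast hm
  have h := Complex.mul_cpow_ofReal_nonneg (a := 2) (b := m / 2) (by norm_num) (by positivity) z
  push_cast at h
  rw [mul_div_cancel₀ _ (two_ne_zero' ℂ)] at h
  rw [powerFn, if_neg (div_ne_zero hm' two_ne_zero), natPow, h, ← mul_assoc,
    ← Complex.cpow_add _ _ two_ne_zero]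
  simp

theorem powerFn_neg_half {m : ℕ} (hm : m ≠ 0) (z : ℂ) :
    powerFn z (-(m / 2)) = Complex.exp (Real.pi * Complex.I * z) * 2 ^ (-z) * natPow z m := by
  have hm' : (m : ℂ) ≠ 0 := by exact_mod_cast hm
  have h := powerFn_half hm z
  rw [powerFn, if_neg (div_ne_zero hm' two_ne_zero)] at h
  have h1 := Complex.ofReal_cpow_of_nonpos (x := -(m / 2)) (by
    have : (0 : ℝ) ≤ m / 2 := by positivity
    linarith) z
  push_cast at h1
  rw [neg_neg] at h1
  rw [powerFn, if_neg (neg_ne_zero.2 (div_ne_zero hm' two_ne_zero)), h1, h]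
  ring

theorem sum_Ico_add_two {g : ℕ → ℂ} {K : ℕ} (hK : 1 ≤ K) :
    ∑ j ∈ Finset.Ico 1 (K + 2), g j = ∑ j ∈ Finset.Ico 1 K, g j + g K + g (K + 1) := by
  rw [Finset.sum_Ico_succ_top (by omega), Finset.sum_Ico_succ_top hK]

theorem intSum_powerFn (z : ℂ) (N : ℕ) :
    intSum (fun ν => powerFn z (ν + 1 - 1) - powerFn z (ν + -1 / 2)) N =
      2 ^ (-z) * ∑ j ∈ Finset.Ico 1 (2 * N + 1), (-1) ^ j * natPow z j := by
  induction N with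
  | zero => simp [intSum_zero]
  | succ N ih =>
    have h1 : ((N + 1 : ℤ) : ℂ) + 1 - 1 = ((2 * N + 2 : ℕ) : ℂ) / 2 := by push_cast; ring
    have h2 : ((N + 1 : ℤ) : ℂ) + -1 / 2 = ((2 * N + 1 : ℕ) : ℂ) / 2 := by push_cast; ring
    rw [Nat.cast_succ, intSum_add_one, ih, h1, h2, powerFn_half (by omega), powerFn_half (by omega),
      show 2 * (N + 1) + 1 = 2 * N + 1 + 2 by ring, sum_Ico_add_two (by omega)]
    simp only [pow_succ, pow_mul]
    norm_num
    ring

theorem intSum_powerFn_neg (z : ℂ) (N : ℕ) :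
    intSum (fun ν => powerFn z (ν + 1 - 1) - powerFn z (ν + -1 / 2)) (-(N + 1)) =
      -(Complex.exp (Real.pi * Complex.I * z) * 2 ^ (-z) *
        ∑ j ∈ Finset.Ico 1 (2 * N + 2), (-1) ^ j * natPow z j) := by
  have hstep : ∀ (g : ℤ → ℂ) (K : ℕ), intSum g (-(K + 1)) = intSum g (-K) - g (-K) := by
    intro g K
    have h := intSum_add_one g (-(K + 1))
    rw [show -((K : ℤ) + 1) + 1 = -K by ring] at h
    rw [h]; ring
  induction N with
  | zero =>
    have h2 : (-1 / 2 : ℂ) = -(((1 : ℕ) : ℂ) / 2) := by push_cast; ring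
    rw [hstep, h2]
    simp only [Nat.cast_zero, neg_zero, intSum_zero, Int.cast_zero, zero_add, sub_self]
    rw [powerFn_neg_half one_ne_zero]
    -- The term at `ν = 0` uses the convention `0 ^ z = 0`, also for `z = 0`.
    simp [powerFn]
  | succ N ih =>
    have h1 : ((-((N + 1 : ℕ) : ℤ) : ℤ) : ℂ) + 1 - 1 = -(((2 * N + 2 : ℕ) : ℂ) / 2) := by
      push_cast; ring
    have h2 : ((-((N + 1 : ℕ) : ℤ) : ℤ) : ℂ) + -1 / 2 = -(((2 * N + 3 : ℕ) : ℂ) / 2) := by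
      push_cast; ring
    rw [hstep, h1, h2, powerFn_neg_half (by omega), powerFn_neg_half (by omega), Nat.cast_succ, ih,
      show 2 * (N + 1) + 2 = 2 * N + 2 + 2 by ring, sum_Ico_add_two (K := 2 * N + 2) (by omega)]
    simp only [pow_succ, pow_mul]
    norm_num
    ring

theorem hasRightFracSum_powerFn {z : ℂ} {d : ℕ} (hd : 0 < d) (hz : z.re ≤ d - 2) :
    HasRightFracSum (powerFn z) 1 (-1 / 2) (2 ^ (-z) * eulerLimit d z) := by
  have hM : Tendsto (fun n : ℤ => (2 * n + 1).toNat) atTop atTop := by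
    refine tendsto_atTop.2 fun b => ?_
    filter_upwards [eventually_ge_atTop (b : ℤ)] with n hn
    omega
  have hval : ∀ N k : ℕ, powerFn z (((N : ℤ) : ℂ) + (1 / 2 + 1 / 2 * k)) =
      2 ^ (-z) * natPow z (2 * N + 1 + k) := fun N k => by
    rw [← powerFn_half (by omega)]
    congr 1
    push_cast; ring
  obtain ⟨p, hp, hpf, hlim⟩ := exists_interpolating_approxPoly (l := atTop) (f := powerFn z)
    (x₀ := 1 / 2) (c := 1 / 2) (A := 2 ^ (-z)) (by norm_num) hd hz hM (by
      filter_upwards [eventually_ge_atTop 0] with n hn k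
      lift n to ℕ using hn
      exact hval n k)
  refine hasRightFracSum_of_tendsto hp hlim
    ((((tendsto_eulerPartialSum_natPow hz).comp hM).const_mul _).congr' ?_)
  filter_upwards [eventually_ge_atTop 0] with n hn
  lift n to ℕ using hn
  have hN : (2 * (n : ℤ) + 1).toNat = 2 * n + 1 := by omega
  rw [Function.comp_apply, hN, fracSumApprox, intSum_powerFn, polyFracSum_eq_eulerTransform hd (hp _),
    eulerTransform_congr_zero (m := 2 * n + 1) (ψ := fun i => 2 ^ (-z) * natPow z i)
      fun i hi => (hpf n i hi).trans (hval n i), eulerTransform_const_mul, eulerPartialSum]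
  simp only [pow_succ, pow_mul]
  norm_num
  ring

theorem hasLeftFracSum_powerFn {z : ℂ} {d : ℕ} (hd : 2 ≤ d) (hz : z.re ≤ d - 2) :
    HasLeftFracSum (powerFn z) 1 (-1 / 2)
      (-(Complex.exp (Real.pi * Complex.I * z) * 2 ^ (-z) * eulerLimit d z)) := by
  set A := Complex.exp (Real.pi * Complex.I * z) * 2 ^ (-z)
  have hM : Tendsto (fun n : ℤ => (-2 * n - 2).toNat) atBot atTop := by
    refine tendsto_atTop.2 fun b => ?_
    filter_upwards [eventually_le_atBot (-(b : ℤ) - 2)] with n hn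
    omega
  have hval : ∀ N k : ℕ, N ≠ 0 → powerFn z (((-(N + 1) : ℤ) : ℂ) + (1 + -1 / 2 * k)) =
      A * natPow z (2 * N + k) := fun N k hN => by
    rw [← powerFn_neg_half (by omega)]
    congr 1
    push_cast; ring
  -- `N = 0` is excluded: the first node would be the origin, where `powerFn` and `natPow` may
  -- differ.
  have hex : ∀ n : ℤ, n ≤ -2 → ∃ N : ℕ, N ≠ 0 ∧ n = -(N + 1) ∧ (-2 * n - 2).toNat = 2 * N :=
    fun n hn => ⟨(-n - 1).toNat, by omega, by omega, by omega⟩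
  obtain ⟨p, hp, hpf, hlim⟩ := exists_interpolating_approxPoly (l := atBot) (f := powerFn z)
    (x₀ := 1) (c := -1 / 2) (A := A) (by norm_num) (by omega) hz hM (by
      filter_upwards [eventually_le_atBot (-2)] with n hn k
      obtain ⟨N, hN, rfl, hN2⟩ := hex n hn
      rw [hN2]
      exact hval N k hN)
  refine hasLeftFracSum_of_tendsto hp hlim
    ((((tendsto_eulerPartialSum_natPow hz).comp hM).const_mul A).neg.congr' ?_)
  filter_upwards [eventually_le_atBot (-2)] with n hn
  obtain ⟨N, hN, rfl, hN2⟩ := hex n hn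
  have hpv := fun k hk => (hpf (-(N + 1)) k hk).trans (hval N k hN)
  -- The first two nodes give the extra values in the leftward formula; they cancel the last two
  -- terms of the sum up to `2 * N + 1`. Both are interpolation nodes because `2 ≤ d`.
  have h0 := hpv 0 (by omega)
  have h1 := hpv 1 (by omega)
  have e0 : (1 : ℂ) + -1 / 2 * ((0 : ℕ) : ℂ) = 1 := by simp
  have e1 : (1 : ℂ) + -1 / 2 * ((1 : ℕ) : ℂ) = 1 / 2 := by norm_num
  rw [e0] at h0
  rw [e1] at h1
  rw [Function.comp_apply, hN2, fracSumApprox, intSum_powerFn_neg,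
    polyFracSum_eq_eulerTransform_neg (by omega) (hp _), h0, h1,
    eulerTransform_congr_zero (m := 2 * N) (ψ := fun i => A * natPow z i) hpv,
    eulerTransform_const_mul, eulerPartialSum, sum_Ico_add_two (by omega)]
  simp only [pow_succ, pow_mul]
  norm_num
  ring

theorem mainTheorem9 (z : ℂ) (hz : ∀ k : ℤ, z ≠ 2 * (k : ℂ) + 1) (h2 : (2 : ℂ) ^ (-z) ≠ 2) :
    (∃! s : ℂ, HasRightFracSum (powerFn z) 1 (-1 / 2) s) ∧
    (∃! s : ℂ, HasLeftFracSum (powerFn z) 1 (-1 / 2) s) ∧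
    (rightFracSum (powerFn z) 1 (-1 / 2) = leftFracSum (powerFn z) 1 (-1 / 2) ↔
      riemannZeta (-z) = 0) := by
  obtain ⟨e, he⟩ := exists_nat_gt z.re
  have hzd : z.re < ((e + 2 : ℕ) : ℝ) - 2 := by push_cast; linarith
  have hr := hasRightFracSum_powerFn (by omega) hzd.le
  have hl := hasLeftFracSum_powerFn (by omega) hzd.le
  refine ⟨⟨_, hr, fun s hs => hs.unique hr⟩, ⟨_, hl, fun s hs => hs.unique hl⟩, ?_⟩
  -- The pole of `ζ(-z)` is at the odd integer `z = -1`.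
  have hz1 : z ≠ -1 := fun h => hz (-1) (by rw [h]; norm_num)
  rw [hr.rightFracSum_eq, hl.leftFracSum_eq, eulerLimit_eq hzd hz1]
  have hpow : (2 : ℂ) ^ (-z) ≠ 0 := by simp [Complex.cpow_eq_zero_iff]
  have hfac : (2 : ℂ) ^ (1 + z) - 1 ≠ 0 := by
    intro h
    apply h2
    have h3 : (2 : ℂ) ^ (-z) * 2 ^ (1 + z) = 2 := by
      rw [← Complex.cpow_add _ _ two_ne_zero]; simp
    rw [sub_eq_zero.1 h, mul_one] at h3
    exact h3
  have hexp : 1 + Complex.exp (Real.pi * Complex.I * z) ≠ 0 := by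
    intro h
    -- If `exp (π i z) = -1`, then `π i (z - 1)` is a multiple of `2 π i`, so `z` is odd.
    have h3 : Complex.exp (Real.pi * Complex.I * z - Real.pi * Complex.I) = 1 := by
      rw [Complex.exp_sub, Complex.exp_pi_mul_I]
      linear_combination -h
    obtain ⟨k, hk⟩ := Complex.exp_eq_one_iff.1 h3
    refine hz k (mul_left_cancel₀ (a := Real.pi * Complex.I) ?_ ?_)
    · exact mul_ne_zero (by exact_mod_cast Real.pi_ne_zero) Complex.I_ne_zero
    · linear_combination hk
  constructor
  · intro h
    have h3 : (2 : ℂ) ^ (-z) * (2 ^ (1 + z) - 1) *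
        (1 + Complex.exp (Real.pi * Complex.I * z)) * riemannZeta (-z) = 0 := by
      linear_combination h
    exact (mul_eq_zero.1 h3).resolve_left (mul_ne_zero (mul_ne_zero hpow hfac) hexp)
  · intro h
    simp [h]
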